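/- Let $p\ge 0$, let $\mathcal{F}$ be a separable real Hilbert space, let $h:\mathbb{R}^p\to\mathcal{F}$ be differentiable with locally Lipschitz differential $Dh$, and let $R:\mathcal{F}\to[0,\infty)$ be differentiable with (globally) Lipschitz gradient and strongly convex. Let $w_0\in\mathbb{R}^p$ be such that $h(w_0)=0$ and $\operatorname{rank} Dh(w)$ is constant for $w$ in a neighborhood of $w_0$. For $\alpha>0$ put $F_\alpha(w)=\frac1{\alpha^2}R(\alpha h(w))$. Then there exist constants $\alpha_0>0$, $C>0$ and $c>0$ such that for every $\alpha\ge\alpha_0$ (with $C$ and $c$ not depending on $\alpha$) the gradient flow $$w_\alpha(0)=w_0,\qquad w_\alpha'(t)=-\nabla F_\alpha(w_\alpha(t))$$ exists for all $t\ge 0$ and converges to a local minimizer $w_\alpha^\infty$ of $F_\alpha$ at a geometric rate: $$\|w_\alpha(t)-w_\alpha^\infty\|\le \frac{C}{\alpha}\,e^{-ct}\qquad\text{for all } t\ge 0 .$$ -/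

import Mathlib

open Set Filter Topology

noncomputable section

/-- The scaled objective `F_α(w) = R(α h(w)) / α²`. -/
def scaledObjective {E F : Type*} [NormedAddCommGroup F] [InnerProductSpace ℝ F]
    (R : F → ℝ) (h : E → F) (α : ℝ) (w : E) : ℝ :=
  (1 / α ^ 2) * R (α • h w)

/-- `w` is a gradient flow of `f` on `[0, ∞)` started at `w₀`: `w(0) = w₀` and
`w'(t) = -∇f(w(t))` for all `t ≥ 0` (one-sided derivative at `t = 0`). -/
def IsGradientFlow {E : Type*} [NormedAddCommGroup E] [InnerProductSpace ℝ E] [CompleteSpace E]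
    (f : E → ℝ) (w₀ : E) (w : ℝ → E) : Prop :=
  w 0 = w₀ ∧ ∀ t : ℝ, 0 ≤ t → HasDerivWithinAt w (-(gradient f (w t))) (Ici 0) t

end

/-!
The argument is a Polyak–Łojasiewicz inequality near `w₀` that is uniform in `α`, followed by a
trapping argument for the flow.

*Geometry.* With `A = Dh(w₀)` and `K = ker A`, the map `Φ(w) = A* h(w) + P_K (w - w₀)` is a local
diffeomorphism at `w₀`. Since the rank of `Dh` is constant, `ker Dh(w) = ker (A* Dh(w))` near `w₀`,
so in the coordinates `Φ` the map `h` does not change along `K`. Hence any value `h(w')` with `w'`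
near `w₀` is also attained at some `w''` with `‖w'' - w‖ ≤ C ‖h(w') - h(w)‖`
(`exists_lift_norm_sub_le_of_finrank_range_const`).

*Uniform inequality.* Put `g = ∇R(α h(w)) / α` and `d = ‖h(w') - h(w)‖`. Strong convexity bounds
`F_α(w') - F_α(w)` below by `⟪g, h(w') - h(w)⟫ + m d² / 2`. Expanding `h(w'') - h(w)` to first order
at `w` turns the inner product into `⟪∇F_α(w), w'' - w⟫` up to an error `‖g‖ L C² d²`. Because
`h(w₀) = 0`, the norm `‖g‖` is small for `w` close to `w₀` and `α` large, so that the error is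
absorbed by the quadratic term; minimizing over `d` gives
`κ (F_α(w) - F_α(w')) ≤ ‖∇F_α(w)‖²` with `κ = m / C²` (`exists_uniform_polyakLojasiewicz`).

*Flow.* Let `m_α` be the minimum of `F_α` over a small closed ball about `w₀`. While the flow stays
in the ball, `V(t) = α e^{κt/2} (F_α(w(t)) - m_α) + e^{-κt/2} / (κα)` satisfies `‖w'‖ ≤ -V'` and
`V(t) ≤ e^{-κt/2} V(0)`, where `V(0) = O(1/α)`. So the length of the trajectory is `O(1/α)`, which
traps it in the ball for large `α` (`flow_mem_ball`), and it converges at the rate `κ/2` to a point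
where `F_α` takes the value `m_α` (`exists_lim_of_flow`). Existence for all times follows by solving
the equation for the globally Lipschitz field `-∇F_α ∘ π`, with `π` the radial retraction onto the
ball (`exists_isGradientFlow`).
-/

noncomputable section

/-! ### Lifting along a map of constant rank -/

section Geometry

variable {E F : Type*} [NormedAddCommGroup E] [InnerProductSpace ℝ E] [FiniteDimensional ℝ E]
  [NormedAddCommGroup F] [InnerProductSpace ℝ F] [CompleteSpace F]

open ContinuousLinearMap in
/-- The two summands have orthogonal ranges, so that a vector of the kernel is killed by both. -/
theorem injective_adjoint_comp_add_starProjection_ker (A : E →L[ℝ] F) :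
    Function.Injective (adjoint A ∘L A + A.ker.starProjection) := by
  rw [injective_iff_map_eq_zero]
  intro v hv
  set y := A.ker.starProjection v with hy
  have hyK : A y = 0 := A.ker.starProjection_apply_mem v
  have hsum : adjoint A (A v) + y = 0 := by simpa using hv
  have hy0 : y = 0 := by
    have h1 : inner ℝ (adjoint A (A v) + y) y = 0 := by rw [hsum, inner_zero_left]
    rw [inner_add_left, adjoint_inner_left, hyK, inner_zero_right, zero_add] at h1
    exact inner_self_eq_zero.1 h1
  have hAv : A v = 0 := by
    have h1 : inner ℝ (adjoint A (A v)) v = 0 := by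
      rw [hy0, add_zero] at hsum; rw [hsum, inner_zero_left]
    rw [adjoint_inner_left] at h1
    exact inner_self_eq_zero.1 h1
  have : y = v := Submodule.starProjection_eq_self_iff.2 hAv
  rw [← this, hy0]

open ContinuousLinearMap in
/-- The range of `A*` is orthogonal to the kernel of `A`. -/
theorem adjoint_apply_eq_zero_of_add_mem_ker (A : E →L[ℝ] F) {y : F} {k : E}
    (hk : k ∈ A.ker) (h : adjoint A y + k ∈ A.ker) : adjoint A y = 0 := by
  have h1 : A (adjoint A y) = 0 := by
    have h2 : A (adjoint A y + k) = 0 := h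
    have h3 : A k = 0 := hk
    rwa [map_add, h3, add_zero] at h2
  have : inner ℝ (adjoint A y) (adjoint A y) = 0 := by
    rw [adjoint_inner_left, h1, inner_zero_right]
  exact inner_self_eq_zero.1 this

open ContinuousLinearMap in
/-- If `D` has constant rank near `x₀`, then composing `D x` with the adjoint of `D x₀` does not
enlarge its kernel for `x` near `x₀`. The perturbation `(D x₀)* ∘ D x + P` of an invertible map,
with `P` the projection onto `ker D x₀`, maps the larger kernel injectively into `ker D x₀`, whose
dimension is that of `ker D x`. -/
theorem eventually_ker_adjoint_comp_le {X : Type*} [TopologicalSpace X] {D : X → E →L[ℝ] F}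
    {x₀ : X} (hD : ContinuousAt D x₀) {r : ℕ}
    (hr : ∀ᶠ x in 𝓝 x₀, Module.finrank ℝ (LinearMap.range (D x).toLinearMap) = r) :
    ∀ᶠ x in 𝓝 x₀, ∀ v, adjoint (D x₀) (D x v) = 0 → D x v = 0 := by
  set A := D x₀ with hA
  have hr0 := hr.self_of_nhds
  let e : E ≃L[ℝ] E := (LinearEquiv.ofInjectiveEndo _
    (injective_adjoint_comp_add_starProjection_ker A)).toContinuousLinearEquiv
  have he : (e : E →L[ℝ] E) = adjoint A ∘L A + A.ker.starProjection := by ext; rfl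
  have hcont : ContinuousAt (fun x => adjoint A ∘L D x + A.ker.starProjection) x₀ := by
    fun_prop
  have hev : ∀ᶠ x in 𝓝 x₀, (adjoint A ∘L D x + A.ker.starProjection) ∈
      range ((↑) : (E ≃L[ℝ] E) → E →L[ℝ] E) :=
    hcont.eventually (by
      change _ ∈ 𝓝 (adjoint A ∘L A + A.ker.starProjection)
      rw [← he]; exact ContinuousLinearEquiv.nhds e)
  filter_upwards [hr, hev] with x hx ⟨B, hB⟩ v hv
  have hle : (D x).ker ≤ (adjoint A ∘L D x).ker := by
    intro u hu
    have hu' : D x u = 0 := hu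
    change adjoint A (D x u) = 0
    rw [hu', map_zero]
  have hmap : (adjoint A ∘L D x).ker.map (B.toLinearEquiv : E →ₗ[ℝ] E) ≤ A.ker := by
    rintro _ ⟨u, hu, rfl⟩
    have hu' : adjoint A (D x u) = 0 := hu
    have : B u = adjoint A (D x u) + A.ker.starProjection u := by
      have := congrArg (fun T : E →L[ℝ] E => T u) hB
      simpa using this
    change B u ∈ _
    rw [this, hu', zero_add]
    exact A.ker.starProjection_apply_mem u
  have h1 := Submodule.finrank_mono hmap
  rw [LinearEquiv.finrank_map_eq] at h1
  have h2 := LinearMap.finrank_range_add_finrank_ker (D x).toLinearMap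
  have h3 := LinearMap.finrank_range_add_finrank_ker A.toLinearMap
  have heq : (D x).ker = (adjoint A ∘L D x).ker :=
    Submodule.eq_of_le_of_finrank_le hle (h1.trans (by
      change Module.finrank ℝ (LinearMap.ker A.toLinearMap) ≤
        Module.finrank ℝ (LinearMap.ker (D x).toLinearMap)
      rw [hx] at h2; rw [hr0] at h3; omega))
  have : v ∈ (D x).ker := by rw [heq]; exact hv
  exact this

open ContinuousLinearMap in
/-- A quantitative consequence of the constant rank theorem: values of `h` near `h w₀` are attained
close to any given `w`, at a distance controlled linearly by the change of value. The constant `C`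
does not depend on the neighbourhood `U`. -/
theorem exists_lift_norm_sub_le_of_finrank_range_const {h : E → F} (hh : ContDiff ℝ 1 h) {w₀ : E}
    {r : ℕ} (hr : ∀ᶠ w in 𝓝 w₀,
      Module.finrank ℝ (LinearMap.range (fderiv ℝ h w).toLinearMap) = r) :
    ∃ C : ℝ, 0 < C ∧ ∀ U ∈ 𝓝 w₀, ∃ δ > 0, ∀ w ∈ Metric.ball w₀ δ, ∀ w' ∈ Metric.ball w₀ δ,
      ∃ w'' ∈ U, h w'' = h w' ∧ ‖w'' - w‖ ≤ C * ‖h w' - h w‖ := by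
  set A := fderiv ℝ h w₀ with hA
  have hfd : Continuous (fderiv ℝ h) := hh.continuous_fderiv one_ne_zero
  have hdiff : Differentiable ℝ h := hh.differentiable one_ne_zero
  let Φ : E → E := fun w => adjoint A (h w) + A.ker.starProjection (w - w₀)
  let e : E ≃L[ℝ] E := (LinearEquiv.ofInjectiveEndo _
    (injective_adjoint_comp_add_starProjection_ker A)).toContinuousLinearEquiv
  have he : (e : E →L[ℝ] E) = adjoint A ∘L A + A.ker.starProjection := by ext; rfl
  have hΦd : ∀ w, HasFDerivAt Φ (adjoint A ∘L fderiv ℝ h w + A.ker.starProjection) w := by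
    intro w
    exact ((adjoint A).hasFDerivAt.comp w (hdiff w).hasFDerivAt).add
      (A.ker.starProjection.hasFDerivAt.comp w ((hasFDerivAt_id w).sub_const w₀))
  have hΦc : ContDiff ℝ 1 Φ := by
    apply ContDiff.add
    · exact (adjoint A).contDiff.comp hh
    · exact A.ker.starProjection.contDiff.comp (contDiff_id.sub contDiff_const)
  have hΦ0 : HasFDerivAt Φ (e : E →L[ℝ] E) w₀ := by rw [he]; exact hΦd w₀
  let P := hΦc.contDiffAt.toOpenPartialHomeomorph Φ hΦ0 one_ne_zero
  have hP0 : w₀ ∈ P.source := hΦc.contDiffAt.mem_toOpenPartialHomeomorph_source hΦ0 one_ne_zero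
  have hPΦ : ∀ w, P w = Φ w := fun w => by
    rw [hΦc.contDiffAt.toOpenPartialHomeomorph_coe hΦ0 one_ne_zero]
  let Ψ : E → E := P.symm
  have hΨ0 : Ψ (Φ w₀) = w₀ := by rw [← hPΦ]; exact P.left_inv hP0
  have hPt : Φ w₀ ∈ P.target := by rw [← hPΦ]; exact P.map_source hP0
  have hΨc : ContDiffAt ℝ 1 Ψ (Φ w₀) :=
    hΦc.contDiffAt.to_localInverse hΦ0 one_ne_zero
  obtain ⟨K, t, ht, hK⟩ := hΨc.exists_lipschitzOnWith
  have hΨcont : ContinuousAt Ψ (Φ w₀) := hΨc.continuousAt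
  have hker := eventually_ker_adjoint_comp_le (hfd.continuousAt (x := w₀)) hr
  refine ⟨K * ‖adjoint A‖ + 1, by positivity, fun U hU => ?_⟩
  have hU' : ∀ᶠ z in 𝓝 (Φ w₀), Ψ z ∈ U := hΨcont.eventually (by rw [hΨ0]; exact hU)
  have hker' : ∀ᶠ z in 𝓝 (Φ w₀), ∀ v, adjoint A (fderiv ℝ h (Ψ z) v) = 0 →
      fderiv ℝ h (Ψ z) v = 0 := hΨcont.eventually (by rw [hΨ0]; exact hker)
  have htar : ∀ᶠ z in 𝓝 (Φ w₀), z ∈ P.target := P.open_target.mem_nhds hPt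
  have hdΨ : ∀ᶠ z in 𝓝 (Φ w₀), DifferentiableAt ℝ Ψ z :=
    (hΨc.eventually (by simp)).mono fun z hz => hz.differentiableAt one_ne_zero
  obtain ⟨ε, hε, hball⟩ := Metric.eventually_nhds_iff_ball.1
    (hU'.and (hker'.and (htar.and (hdΨ.and ht))))
  have hΦcont : Continuous Φ := hΦc.continuous
  have ev1 : ∀ᶠ w in 𝓝 w₀, Φ w ∈ Metric.ball (Φ w₀) ε :=
    hΦcont.continuousAt.eventually (Metric.ball_mem_nhds _ hε)
  have ev2 : ∀ᶠ w in 𝓝 w₀, w ∈ P.source := P.open_source.mem_nhds hP0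
  have ev3 : ∀ᶠ w in 𝓝 w₀, ‖adjoint A (h w) - adjoint A (h w₀)‖ < ε / 2 := by
    have : Continuous fun w => ‖adjoint A (h w) - adjoint A (h w₀)‖ :=
      (((adjoint A).continuous.comp hh.continuous).sub continuous_const).norm
    exact this.continuousAt.eventually (Iio_mem_nhds (by simpa using hε))
  have ev4 : ∀ᶠ w in 𝓝 w₀, ‖A.ker.starProjection (w - w₀)‖ < ε / 2 := by
    have : Continuous fun w => ‖A.ker.starProjection (w - w₀)‖ := by fun_prop
    exact this.continuousAt.eventually (Iio_mem_nhds (by simpa using hε))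
  obtain ⟨δ, hδ, hδball⟩ := Metric.eventually_nhds_iff_ball.1
    (ev1.and (ev2.and (ev3.and ev4)))
  refine ⟨δ, hδ, fun w hw w' hw' => ?_⟩
  obtain ⟨hw1, hw2, hw3, hw4⟩ := hδball w hw
  obtain ⟨hw1', hw2', hw3', hw4'⟩ := hδball w' hw'
  -- `z` combines the range coordinate of `w'` with the kernel coordinate of `w`
  set z := adjoint A (h w') + A.ker.starProjection (w - w₀) with hz
  have hzball : z ∈ Metric.ball (Φ w₀) ε := by
    rw [mem_ball_iff_norm]
    have : z - Φ w₀ = (adjoint A (h w') - adjoint A (h w₀)) + A.ker.starProjection (w - w₀) := by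
      simp only [hz, Φ, sub_self, map_zero]; abel
    rw [this]
    exact (norm_add_le _ _).trans_lt (by linarith)
  obtain ⟨hz1, -, -, -, hz5⟩ := hball z hzball
  have hwΨ : Ψ (Φ w) = w := by rw [← hPΦ]; exact P.left_inv hw2
  have hwΨ' : Ψ (Φ w') = w' := by rw [← hPΦ]; exact P.left_inv hw2'
  refine ⟨Ψ z, hz1, ?_, ?_⟩
  · -- `h ∘ Ψ` is constant on the segment from `Φ w'` to `z`, whose direction `k` lies in `ker A`
    set k := z - Φ w' with hk
    have hkK : k ∈ A.ker := by
      have : k = A.ker.starProjection (w - w') := by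
        simp only [hk, hz, Φ, map_sub]; abel
      rw [this]; exact A.ker.starProjection_apply_mem _
    have hseg : ∀ s ∈ Icc (0 : ℝ) 1, Φ w' + s • k ∈ Metric.ball (Φ w₀) ε := by
      intro s hs
      exact (convex_ball _ _).add_smul_sub_mem hw1' hzball hs
    have hder : ∀ s ∈ Icc (0 : ℝ) 1, HasDerivAt (fun s : ℝ => h (Ψ (Φ w' + s • k))) 0 s := by
      intro s hs
      obtain ⟨-, hk2, hk3, hk4, -⟩ := hball _ (hseg s hs)
      set y := Φ w' + s • k with hy
      have hline : HasDerivAt (fun s : ℝ => Φ w' + s • k) k s := by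
        simpa using ((hasDerivAt_id s).smul_const k).const_add (Φ w')
      have hΨy := hk4.hasFDerivAt
      have hcomp := (hΦd (Ψ y)).comp y hΨy
      have hid : HasFDerivAt (Φ ∘ Ψ) (ContinuousLinearMap.id ℝ E) y := by
        refine (hasFDerivAt_id y).congr_of_eventuallyEq ?_
        filter_upwards [P.open_target.mem_nhds hk3] with q hq
        change Φ (Ψ q) = q
        rw [← hPΦ]; exact P.right_inv hq
      have heq := congrArg (fun T : E →L[ℝ] E => T k) (hcomp.unique hid)
      set v := fderiv ℝ Ψ y k with hv
      have heq' : adjoint A (fderiv ℝ h (Ψ y) v) + A.ker.starProjection v = k := by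
        simpa using heq
      have hv0 : adjoint A (fderiv ℝ h (Ψ y) v) = 0 :=
        adjoint_apply_eq_zero_of_add_mem_ker A (A.ker.starProjection_apply_mem v)
          (by rw [heq']; exact hkK)
      have := ((hdiff (Ψ y)).hasFDerivAt.comp y hΨy).comp_hasDerivAt s hline
      rw [ContinuousLinearMap.comp_apply, ← hv, hk2 v hv0] at this
      exact this
    have hconst := constant_of_has_deriv_right_zero (a := (0 : ℝ)) (b := 1)
      (fun s hs => (hder s hs).continuousAt.continuousWithinAt)
      (fun s hs => (hder s (Ico_subset_Icc_self hs)).hasDerivWithinAt) 1 (by simp)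
    simpa [hk, hwΨ'] using hconst
  · have hd := hK.dist_le_mul z hz5 (Φ w) (hball _ hw1).2.2.2.2
    rw [hwΨ, dist_eq_norm, dist_eq_norm] at hd
    have hzw : z - Φ w = adjoint A (h w' - h w) := by
      simp only [hz, Φ, map_sub]; abel
    rw [hzw] at hd
    calc ‖Ψ z - w‖ ≤ K * ‖adjoint A (h w' - h w)‖ := hd
      _ ≤ K * (‖adjoint A‖ * ‖h w' - h w‖) := by gcongr; exact le_opNorm _ _
      _ ≤ (K * ‖adjoint A‖ + 1) * ‖h w' - h w‖ := by nlinarith [norm_nonneg (h w' - h w)]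

end Geometry

/-! ### Strong convexity -/

section StrongConvexity

variable {F : Type*} [NormedAddCommGroup F] [InnerProductSpace ℝ F] [CompleteSpace F]

/-- First-order characterization of strong convexity. -/
theorem StrongConvexOn.add_inner_gradient_add_le {R : F → ℝ} {m : ℝ}
    (hR : StrongConvexOn univ m R) {y : F} (hd : DifferentiableAt ℝ R y) (y' : F) :
    R y + inner ℝ (gradient R y) (y' - y) + m / 2 * ‖y' - y‖ ^ 2 ≤ R y' := by
  set v := y' - y with hv
  have hline : HasDerivAt (fun s : ℝ => R (y + s • v)) (inner ℝ (gradient R y) v) 0 := by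
    have h1 : HasDerivAt (fun s : ℝ => y + s • v) v 0 := by
      simpa using ((hasDerivAt_id (0 : ℝ)).smul_const v).const_add y
    have h2 : HasFDerivAt R (InnerProductSpace.toDual ℝ F (gradient R y)) (y + (0 : ℝ) • v) := by
      simpa using hd.hasGradientAt.hasFDerivAt
    simpa [Function.comp_def, inner_gradient_left] using h2.comp_hasDerivAt 0 h1
  have hslope := hline.tendsto_slope_zero_right
  have hlim : Tendsto (fun s : ℝ => R y' - R y - (1 - s) * (m / 2 * ‖v‖ ^ 2)) (𝓝[>] 0)
      (𝓝 (R y' - R y - (1 - 0) * (m / 2 * ‖v‖ ^ 2))) :=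
    (Continuous.tendsto (by fun_prop) 0).mono_left nhdsWithin_le_nhds
  have := le_of_tendsto_of_tendsto hslope hlim (by
    filter_upwards [Ioo_mem_nhdsGT (zero_lt_one (α := ℝ))] with s hs
    have hc := hR.2 (mem_univ y) (mem_univ y') (sub_nonneg.2 hs.2.le) hs.1.le (by ring)
    have hpt : (1 - s) • y + s • y' = y + s • v := by rw [hv]; module
    rw [hpt, norm_sub_rev, ← hv] at hc
    simp only [smul_eq_mul] at hc
    simp only [zero_add, zero_smul, add_zero, smul_eq_mul]
    rw [inv_mul_le_iff₀ hs.1]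
    linarith)
  linarith

end StrongConvexity

/-! ### Gradient flows under a Polyak–Łojasiewicz inequality -/

section Flow

variable {E : Type*} [NormedAddCommGroup E] [InnerProductSpace ℝ E] [CompleteSpace E]

/-- The Lyapunov function `a e^{κt/2} (f (w t) - m) + e^{-κt/2} / (κ a)` along a curve `w`. Compared
with `√(f (w t) - m)`, the usual choice under a Polyak–Łojasiewicz inequality with constant `κ`, it
stays differentiable where `f (w t) = m`; the weight `a > 0` is free. -/
def flowEnergy (f : E → ℝ) (m κ a : ℝ) (w : ℝ → E) (t : ℝ) : ℝ :=
  a * Real.exp (κ / 2 * t) * (f (w t) - m) + Real.exp (-(κ / 2) * t) / (κ * a)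

variable {f : E → ℝ} {m κ a : ℝ} {w : ℝ → E}

theorem hasDerivWithinAt_comp_gradient_flow {s : Set ℝ} {t : ℝ} (hf : DifferentiableAt ℝ f (w t))
    (hw : HasDerivWithinAt w (-(gradient f (w t))) s t) :
    HasDerivWithinAt (fun u => f (w u)) (-‖gradient f (w t)‖ ^ 2) s t := by
  have h := hf.hasFDerivAt.comp_hasDerivWithinAt t hw
  rwa [map_neg, ← inner_gradient_left, real_inner_self_eq_norm_sq] at h

/-- Exponential decay of the Lyapunov function; equivalent to `e^{κt} (f (w t) - m)` not exceeding
its initial value. -/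
theorem flowEnergy_le_exp_mul (hf : Differentiable ℝ f) (ha : 0 < a) {T : ℝ}
    (hwc : ContinuousOn w (Icc 0 T))
    (hw : ∀ t ∈ Ico 0 T, HasDerivWithinAt w (-(gradient f (w t))) (Ici t) t)
    (hPL : ∀ t ∈ Ico 0 T, κ * (f (w t) - m) ≤ ‖gradient f (w t)‖ ^ 2) {t : ℝ} (ht : t ∈ Icc 0 T) :
    flowEnergy f m κ a w t ≤ Real.exp (-(κ / 2) * t) * flowEnergy f m κ a w 0 := by
  have hmono : Real.exp (κ * t) * (f (w t) - m) ≤ f (w 0) - m := by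
    refine image_le_of_deriv_right_le_deriv_boundary (a := 0) (b := T)
      (f := fun t => Real.exp (κ * t) * (f (w t) - m))
      (f' := fun t => Real.exp (κ * t) * κ * (f (w t) - m)
        + Real.exp (κ * t) * (-‖gradient f (w t)‖ ^ 2))
      (B := fun _ => f (w 0) - m) (B' := fun _ => 0) ?_ ?_ (by simp)
      continuousOn_const (fun x _ => hasDerivWithinAt_const _ _ _) ?_ ht
    · have := hf.continuous.comp_continuousOn hwc
      exact (Continuous.continuousOn (by fun_prop)).mul (this.sub continuousOn_const)
    · intro x hx
      have h1 : HasDerivAt (fun t => Real.exp (κ * t)) (Real.exp (κ * x) * κ) x := by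
        simpa using ((hasDerivAt_id x).const_mul κ).exp
      exact h1.hasDerivWithinAt.mul
        ((hasDerivWithinAt_comp_gradient_flow (hf _) (hw x hx)).sub_const m)
    · intro x hx
      nlinarith [hPL x hx, Real.exp_pos (κ * x)]
  have hexp : Real.exp (κ / 2 * t) = Real.exp (-(κ / 2) * t) * Real.exp (κ * t) := by
    rw [← Real.exp_add]; ring_nf
  unfold flowEnergy
  rw [hexp]
  simp only [mul_zero, Real.exp_zero, mul_one]
  have := mul_le_mul_of_nonneg_left hmono (mul_pos ha (Real.exp_pos (-(κ / 2) * t))).le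
  calc _ = a * Real.exp (-(κ / 2) * t) * (Real.exp (κ * t) * (f (w t) - m))
        + Real.exp (-(κ / 2) * t) / (κ * a) := by ring
    _ ≤ a * Real.exp (-(κ / 2) * t) * (f (w 0) - m) + Real.exp (-(κ / 2) * t) / (κ * a) := by
        linarith
    _ = _ := by ring

/-- The Lyapunov function controls the length of the trajectory. -/
theorem norm_sub_le_flowEnergy_sub (hf : Differentiable ℝ f) (ha : 0 < a) (hκ : 0 < κ) {s t : ℝ}
    (hst : s ≤ t) (hwc : ContinuousOn w (Icc s t))
    (hw : ∀ u ∈ Ico s t, HasDerivWithinAt w (-(gradient f (w u))) (Ici u) u)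
    (hPL : ∀ u ∈ Ico s t, κ * (f (w u) - m) ≤ ‖gradient f (w u)‖ ^ 2) :
    ‖w t - w s‖ ≤ flowEnergy f m κ a w s - flowEnergy f m κ a w t := by
  have hfc := hf.continuous.comp_continuousOn hwc
  refine image_norm_le_of_norm_deriv_right_le_deriv_boundary' (a := s) (b := t)
    (f := fun u => w u - w s) (f' := fun u => -(gradient f (w u)))
    (B := fun u => flowEnergy f m κ a w s - flowEnergy f m κ a w u)
    (B' := fun u => -((a * (Real.exp (κ / 2 * u) * (κ / 2))) * (f (w u) - m)
      + a * Real.exp (κ / 2 * u) * (-‖gradient f (w u)‖ ^ 2)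
      + (Real.exp (-(κ / 2) * u) * (-(κ / 2))) / (κ * a)))
    (hwc.sub continuousOn_const) (fun u hu => (hw u hu).sub_const _) (by simp) ?_ ?_ ?_
    (right_mem_Icc.2 hst)
  · refine continuousOn_const.sub (ContinuousOn.add ?_ (Continuous.continuousOn (by fun_prop)))
    exact (Continuous.continuousOn (by fun_prop)).mul (hfc.sub continuousOn_const)
  · intro u hu
    have h1 : HasDerivAt (fun t => Real.exp (κ / 2 * t)) (Real.exp (κ / 2 * u) * (κ / 2)) u := by
      simpa using ((hasDerivAt_id u).const_mul (κ / 2)).exp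
    have h2 : HasDerivAt (fun t => Real.exp (-(κ / 2) * t))
        (Real.exp (-(κ / 2) * u) * (-(κ / 2))) u := by
      simpa using ((hasDerivAt_id u).const_mul (-(κ / 2))).exp
    exact ((((h1.const_mul a).hasDerivWithinAt.mul
      ((hasDerivWithinAt_comp_gradient_flow (hf _) (hw u hu)).sub_const m))).add
      (h2.div_const (κ * a)).hasDerivWithinAt).const_sub _
  · intro u hu
    have hPLu := hPL u hu
    rw [norm_neg]
    set g := ‖gradient f (w u)‖
    have hinv : Real.exp (-(κ / 2) * u) = (Real.exp (κ / 2 * u))⁻¹ := by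
      rw [← Real.exp_neg]; ring_nf
    rw [hinv]
    set l := a * Real.exp (κ / 2 * u) with hl
    have hlpos : 0 < l := mul_pos ha (Real.exp_pos _)
    have e1 : (Real.exp (κ / 2 * u))⁻¹ * (-(κ / 2)) / (κ * a) = -(1 / (2 * l)) := by
      rw [hl]
      have := Real.exp_pos (κ / 2 * u)
      field_simp
    rw [e1]
    -- Young's inequality `g ≤ l g² / 2 + 1 / (2 l)`
    have hyoung : g ≤ l / 2 * g ^ 2 + 1 / (2 * l) := by
      have : l / 2 * g ^ 2 + 1 / (2 * l) - g = (l * g - 1) ^ 2 / (2 * l) := by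
        field_simp; ring
      have h2 : 0 ≤ (l * g - 1) ^ 2 / (2 * l) := by positivity
      linarith
    have : a * (Real.exp (κ / 2 * u) * (κ / 2)) * (f (w u) - m) = l / 2 * (κ * (f (w u) - m)) := by
      rw [hl]; ring
    rw [this]
    have := mul_le_mul_of_nonneg_left hPLu (half_pos hlpos).le
    linarith

/-- Trapping: a curve that follows the gradient flow while it is in the ball never leaves it. The
flow equation is assumed only inside the ball, so that the lemma also applies to a field modified
outside. -/
theorem flow_mem_ball (hf : Differentiable ℝ f) (ha : 0 < a) (hκ : 0 < κ) {x₀ : E} {ρ : ℝ}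
    (hρ : 0 ≤ ρ)
    (hw0 : w 0 = x₀) (hwc : ContinuousOn w (Ici 0))
    (hw : ∀ t, 0 ≤ t → w t ∈ Metric.ball x₀ ρ →
      HasDerivWithinAt w (-(gradient f (w t))) (Ici 0) t)
    (hm : ∀ x ∈ Metric.closedBall x₀ ρ, m ≤ f x)
    (hPL : ∀ x ∈ Metric.ball x₀ ρ, κ * (f x - m) ≤ ‖gradient f x‖ ^ 2)
    (hsmall : a * (f x₀ - m) + 1 / (κ * a) < ρ) {t : ℝ} (ht : 0 ≤ t) :
    w t ∈ Metric.ball x₀ ρ := by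
  by_contra hcon
  have hclosed : IsClosed (Icc 0 t ∩ (fun s => ‖w s - x₀‖) ⁻¹' Ici ρ) :=
    ((hwc.mono Icc_subset_Ici_self).sub continuousOn_const).norm.preimage_isClosed_of_isClosed
      isClosed_Icc isClosed_Ici
  have hcomp : IsCompact (Icc 0 t ∩ (fun s => ‖w s - x₀‖) ⁻¹' Ici ρ) :=
    isCompact_Icc.of_isClosed_subset hclosed inter_subset_left
  -- `T` is the first exit time
  obtain ⟨T, ⟨hT, hTρ⟩, hTmin⟩ := hcomp.exists_isLeast
    ⟨t, ⟨ht, le_rfl⟩, by simpa [mem_ball_iff_norm, dist_eq_norm] using hcon⟩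
  have hbefore : ∀ s ∈ Ico 0 T, w s ∈ Metric.ball x₀ ρ := by
    intro s hs
    by_contra hs'
    have : T ≤ s := hTmin ⟨⟨hs.1, hs.2.le.trans hT.2⟩, by
      simpa [mem_ball_iff_norm, dist_eq_norm] using hs'⟩
    exact absurd hs.2 this.not_gt
  have hlen := norm_sub_le_flowEnergy_sub (m := m) hf ha hκ hT.1 (hwc.mono Icc_subset_Ici_self)
    (fun u hu => (hw u hu.1 (hbefore u hu)).mono (Ici_subset_Ici.2 hu.1))
    (fun u hu => hPL _ (hbefore u hu))
  have hE0 : flowEnergy f m κ a w 0 = a * (f x₀ - m) + 1 / (κ * a) := by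
    simp [flowEnergy, hw0]
  -- the exit point lies in the closed ball, where the energy is still nonnegative
  have hTc : w T ∈ Metric.closedBall x₀ ρ := by
    rcases hT.1.eq_or_lt with h0 | h0
    · rw [← h0, hw0]; exact Metric.mem_closedBall_self hρ
    · have hcl : T ∈ closure (Ico 0 T) := by rw [closure_Ico h0.ne]; exact ⟨h0.le, le_rfl⟩
      have := ((hwc T hT.1).mono (fun s hs => hs.1 : Ico 0 T ⊆ Ici 0)).mem_closure hcl hbefore
      exact Metric.closure_ball_subset_closedBall this
  have hET : 0 ≤ flowEnergy f m κ a w T := by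
    have := sub_nonneg.2 (hm _ hTc)
    unfold flowEnergy
    positivity
  have : ρ ≤ ‖w T - x₀‖ := hTρ
  rw [hw0] at hlen
  linarith

/-- The limit lies in the open ball and attains the lower bound `m`, hence is a local minimizer. -/
theorem exists_lim_of_flow (hf : Differentiable ℝ f) (ha : 0 < a) (hκ : 0 < κ) {x₀ : E} {ρ : ℝ}
    (hρ : 0 ≤ ρ)
    (hw : IsGradientFlow f x₀ w)
    (hm : ∀ x ∈ Metric.closedBall x₀ ρ, m ≤ f x)
    (hPL : ∀ x ∈ Metric.ball x₀ ρ, κ * (f x - m) ≤ ‖gradient f x‖ ^ 2)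
    (hsmall : a * (f x₀ - m) + 1 / (κ * a) < ρ) :
    ∃ x, IsLocalMin f x ∧ ∀ t, 0 ≤ t →
      ‖w t - x‖ ≤ (a * (f x₀ - m) + 1 / (κ * a)) * Real.exp (-(κ / 2) * t) := by
  obtain ⟨hw0, hwd⟩ := hw
  have hwc : ContinuousOn w (Ici 0) := fun t ht => (hwd t ht).continuousWithinAt
  have hball : ∀ t, 0 ≤ t → w t ∈ Metric.ball x₀ ρ := fun t ht =>
    flow_mem_ball hf ha hκ hρ hw0 hwc (fun t ht _ => hwd t ht) hm hPL hsmall ht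
  set V := a * (f x₀ - m) + 1 / (κ * a) with hV
  have hE0 : flowEnergy f m κ a w 0 = V := by simp [flowEnergy, hw0, hV]
  have hdec : ∀ t, 0 ≤ t → flowEnergy f m κ a w t ≤ V * Real.exp (-(κ / 2) * t) := by
    intro t ht
    rw [mul_comm, ← hE0]
    exact flowEnergy_le_exp_mul hf ha (hwc.mono Icc_subset_Ici_self)
      (fun u hu => (hwd u hu.1).mono (Ici_subset_Ici.2 hu.1))
      (fun u hu => hPL _ (hball u hu.1)) ⟨ht, le_rfl⟩
  have hpos : ∀ t, 0 ≤ t → 0 ≤ flowEnergy f m κ a w t := by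
    intro t ht
    have := sub_nonneg.2 (hm _ (Metric.ball_subset_closedBall (hball t ht)))
    unfold flowEnergy
    positivity
  have hdist : ∀ s t, 0 ≤ s → s ≤ t →
      ‖w t - w s‖ ≤ flowEnergy f m κ a w s - flowEnergy f m κ a w t := by
    intro s t hs hst
    have hsub : Icc s t ⊆ Ici 0 := fun u hu => hs.trans hu.1
    exact norm_sub_le_flowEnergy_sub hf ha hκ hst (hwc.mono hsub)
      (fun u hu => (hwd u (hs.trans hu.1)).mono (Ici_subset_Ici.2 (hs.trans hu.1)))
      (fun u hu => hPL _ (hball u (hs.trans hu.1)))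
  have hdist' : ∀ s t, 0 ≤ s → s ≤ t → ‖w t - w s‖ ≤ V * Real.exp (-(κ / 2) * s) := by
    intro s t hs hst
    linarith [hdist s t hs hst, hdec s hs, hpos t (hs.trans hst)]
  have hexp0 : Tendsto (fun t : ℝ => Real.exp (-(κ / 2) * t)) atTop (𝓝 0) := by
    refine Real.tendsto_exp_atBot.comp ?_
    exact tendsto_id.const_mul_atTop_of_neg (by linarith)
  have hcauchy : CauchySeq fun t : ℝ => w (max t 0) := by
    refine cauchySeq_of_le_tendsto_0
      (fun t : ℝ => V * Real.exp (-(κ / 2) * max t 0) + V * Real.exp (-(κ / 2) * max t 0)) ?_ ?_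
    · intro s t N hs ht
      have h1 := hdist' (max N 0) (max s 0) (le_max_right _ _) (max_le_max_right 0 hs)
      have h2 := hdist' (max N 0) (max t 0) (le_max_right _ _) (max_le_max_right 0 ht)
      refine (dist_triangle_right _ _ (w (max N 0))).trans ?_
      rw [dist_eq_norm, dist_eq_norm]
      exact add_le_add h1 h2
    · have hmax : Tendsto (fun t : ℝ => max t 0) atTop atTop :=
        tendsto_atTop_mono (fun t => le_max_left t 0) tendsto_id
      have := (hexp0.comp hmax).const_mul V
      simpa using this.add this
  obtain ⟨x, hx⟩ := cauchySeq_tendsto_of_complete hcauchy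
  have hx : Tendsto w atTop (𝓝 x) := by
    refine hx.congr' ?_
    filter_upwards [eventually_ge_atTop 0] with t ht
    rw [max_eq_left ht]
  have hbound : ∀ t, 0 ≤ t → ‖w t - x‖ ≤ V * Real.exp (-(κ / 2) * t) := by
    intro t ht
    refine le_of_tendsto (hx.const_sub (w t)).norm ?_
    filter_upwards [eventually_ge_atTop t] with u hu
    rw [norm_sub_rev]
    exact hdist' t u ht hu
  refine ⟨x, ?_, hbound⟩
  have hxball : x ∈ Metric.ball x₀ ρ := by
    have := hbound 0 le_rfl
    rw [hw0, mul_zero, Real.exp_zero, mul_one, norm_sub_rev] at this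
    exact mem_ball_iff_norm.2 (this.trans_lt hsmall)
  -- the energy dominates `a (f (w t) - m)`, so that `f (w t) → m`
  have hfx : f x ≤ m := by
    have h1 : Tendsto (fun t => f (w t)) atTop (𝓝 (f x)) := (hf.continuous.tendsto x).comp hx
    have h2 : Tendsto (fun t => m + V / a * Real.exp (-(κ / 2) * t)) atTop (𝓝 (m + V / a * 0)) :=
      (hexp0.const_mul _).const_add _
    rw [mul_zero, add_zero] at h2
    refine le_of_tendsto_of_tendsto h1 h2 ?_
    filter_upwards [eventually_ge_atTop 0] with t ht
    have h3 := hdec t ht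
    have h4 : a * (f (w t) - m) ≤ flowEnergy f m κ a w t := by
      unfold flowEnergy
      have h5 : 1 ≤ Real.exp (κ / 2 * t) := Real.one_le_exp (by positivity)
      have h6 := sub_nonneg.2 (hm _ (Metric.ball_subset_closedBall (hball t ht)))
      have h7 : 0 ≤ Real.exp (-(κ / 2) * t) / (κ * a) := by positivity
      have h8 := mul_le_mul_of_nonneg_right h5 (mul_nonneg ha.le h6)
      nlinarith
    have h9 : f (w t) - m ≤ V * Real.exp (-(κ / 2) * t) / a := by
      rw [le_div_iff₀ ha]; linarith
    have : V / a * Real.exp (-(κ / 2) * t) = V * Real.exp (-(κ / 2) * t) / a := by ring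
    linarith
  filter_upwards [Metric.isOpen_ball.mem_nhds hxball] with y hy
  exact hfx.trans (hm y (Metric.ball_subset_closedBall hy))

end Flow

/-! ### Global existence of trapped gradient flows -/

section Existence

/-- The radial retraction of a normed space onto `closedBall x₀ ρ`. -/
def ballRetraction {E : Type*} [NormedAddCommGroup E] [NormedSpace ℝ E] (x₀ : E) (ρ : ℝ) (x : E) :
    E :=
  x₀ + (ρ / max ρ ‖x - x₀‖) • (x - x₀)

variable {E : Type*} [NormedAddCommGroup E] [NormedSpace ℝ E]

theorem ballRetraction_eq_self {x₀ x : E} {ρ : ℝ} (hρ : 0 < ρ) (hx : x ∈ Metric.closedBall x₀ ρ) :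
    ballRetraction x₀ ρ x = x := by
  rw [mem_closedBall_iff_norm] at hx
  rw [ballRetraction, max_eq_left hx, div_self hρ.ne', one_smul, add_sub_cancel]

theorem ballRetraction_mem_closedBall (x₀ x : E) {ρ : ℝ} (hρ : 0 < ρ) :
    ballRetraction x₀ ρ x ∈ Metric.closedBall x₀ ρ := by
  have hmax : 0 < max ρ ‖x - x₀‖ := lt_max_of_lt_left hρ
  rw [mem_closedBall_iff_norm, ballRetraction, add_sub_cancel_left, norm_smul, Real.norm_of_nonneg
    (by positivity), div_mul_eq_mul_div, div_le_iff₀ hmax]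
  gcongr
  exact le_max_right _ _

theorem lipschitzWith_ballRetraction (x₀ : E) {ρ : ℝ} (hρ : 0 < ρ) :
    LipschitzWith 2 (ballRetraction x₀ ρ) := by
  refine LipschitzWith.of_dist_le_mul fun x y => ?_
  rw [dist_eq_norm, dist_eq_norm]
  set u := x - x₀ with hu
  set v := y - x₀ with hv
  have huv : x - y = u - v := by rw [hu, hv]; abel
  set M := max ρ ‖u‖ with hM
  set N := max ρ ‖v‖ with hN
  have hMpos : 0 < M := lt_max_of_lt_left hρ
  have hNpos : 0 < N := lt_max_of_lt_left hρ
  have hdiff : ballRetraction x₀ ρ x - ballRetraction x₀ ρ y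
      = (ρ / M) • (u - v) + (ρ / M - ρ / N) • v := by
    simp only [ballRetraction, ← hu, ← hv, ← hM, ← hN]; module
  have hMN : |M - N| ≤ ‖u - v‖ :=
    (by rw [hM, hN, max_comm ρ, max_comm ρ]; exact abs_max_sub_max_le_abs _ _ _ :
      |M - N| ≤ |‖u‖ - ‖v‖|).trans (abs_norm_sub_norm_le u v)
  have h1 : ‖(ρ / M) • (u - v)‖ ≤ ‖u - v‖ := by
    rw [norm_smul, Real.norm_of_nonneg (by positivity)]
    exact mul_le_of_le_one_left (norm_nonneg _) ((div_le_one hMpos).2 (le_max_left _ _))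
  have h2 : ‖(ρ / M - ρ / N) • v‖ ≤ ‖u - v‖ := by
    have e : ρ / M - ρ / N = (ρ / M) * ((N - M) / N) := by field_simp
    rw [norm_smul, e, Real.norm_eq_abs, abs_mul, abs_of_nonneg (by positivity : 0 ≤ ρ / M),
      abs_div, abs_of_pos hNpos, abs_sub_comm]
    have h3 : ρ / M ≤ 1 := (div_le_one hMpos).2 (le_max_left _ _)
    have h4 : ‖v‖ / N ≤ 1 := (div_le_one hNpos).2 (le_max_right _ _)
    calc ρ / M * (|M - N| / N) * ‖v‖ = (ρ / M) * |M - N| * (‖v‖ / N) := by ring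
      _ ≤ 1 * |M - N| * 1 := by gcongr
      _ ≤ ‖u - v‖ := by simpa using hMN
  rw [hdiff, huv]
  refine (norm_add_le _ _).trans ?_
  push_cast
  linarith

open scoped NNReal in
/-- A bounded Lipschitz vector field has an integral curve on `[0, ∞)`: boundedness lets
Picard–Lindelöf apply on each `[0, n]`, and the solutions agree by uniqueness. -/
theorem exists_forall_hasDerivWithinAt_Ici_of_lipschitzWith_of_bounded [CompleteSpace E]
    {X : E → E} {K L : ℝ≥0} (hX : LipschitzWith K X) (hL : ∀ x, ‖X x‖ ≤ L) (x₀ : E) :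
    ∃ w : ℝ → E, w 0 = x₀ ∧ ∀ t, 0 ≤ t → HasDerivWithinAt w (X (w t)) (Ici 0) t := by
  have hloc : ∀ n : ℕ, ∃ α : ℝ → E, α 0 = x₀ ∧
      ∀ t ∈ Icc (0 : ℝ) n, HasDerivWithinAt α (X (α t)) (Icc 0 (n : ℝ)) t := by
    intro n
    have hpl : IsPicardLindelof (fun _ => X) (tmin := 0) (tmax := n)
        ⟨0, left_mem_Icc.2 n.cast_nonneg⟩ x₀ (L * n) 0 L K :=
      IsPicardLindelof.of_time_independent (fun x _ => hL x) hX.lipschitzOnWith (by simp)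
    exact hpl.exists_eq_forall_mem_Icc_hasDerivWithinAt₀
  choose α hα0 hα using hloc
  have hcont : ∀ n, ContinuousOn (α n) (Icc 0 (n : ℝ)) := fun n t ht =>
    (hα n t ht).continuousWithinAt
  have hright : ∀ n : ℕ, ∀ t ∈ Ico (0 : ℝ) n, HasDerivWithinAt (α n) (X (α n t)) (Ici t) t :=
    fun n t ht => (hα n t (Ico_subset_Icc_self ht)).mono_of_mem_nhdsWithin
      (mem_of_superset (Icc_mem_nhdsGE ht.2) (Icc_subset_Icc_left ht.1))
  have hagree : ∀ n k : ℕ, n ≤ k → EqOn (α n) (α k) (Icc 0 (n : ℝ)) := by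
    intro n k hnk
    have hnk' : (n : ℝ) ≤ k := by exact_mod_cast hnk
    exact ODE_solution_unique (v := fun _ => X) (fun _ => hX) (hcont n) (hright n)
      ((hcont k).mono (Icc_subset_Icc_right hnk'))
      (fun t ht => hright k t ⟨ht.1, ht.2.trans_le hnk'⟩) (by rw [hα0, hα0])
  -- at time `t` use the solution on `[0, n]` with `n = ⌊t⌋ + 1 > t`
  let w : ℝ → E := fun t => α (⌊t⌋₊ + 1) t
  have hw : ∀ n : ℕ, EqOn w (α n) (Ico 0 (n : ℝ)) := by
    intro n t ht
    have hlt : ⌊t⌋₊ < n := (Nat.floor_lt ht.1).2 ht.2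
    exact hagree _ _ hlt ⟨ht.1, by push_cast; exact (Nat.lt_floor_add_one t).le⟩
  refine ⟨w, by simp [w, hα0], fun t ht => ?_⟩
  obtain ⟨n, hn⟩ := exists_nat_gt t
  have hmem : Ico 0 (n : ℝ) ∈ 𝓝[Ici 0] t :=
    mem_nhdsWithin.2 ⟨Iio n, isOpen_Iio, hn, fun s hs => ⟨hs.2, hs.1⟩⟩
  have h1 : HasDerivWithinAt (α n) (X (α n t)) (Ici 0) t :=
    (hα n t ⟨ht, hn.le⟩).mono_of_mem_nhdsWithin (mem_of_superset hmem Ico_subset_Icc_self)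
  rw [hw n ⟨ht, hn⟩]
  exact h1.congr_of_eventuallyEq (by filter_upwards [hmem] with s hs using hw n hs) (hw n ⟨ht, hn⟩)

end Existence

section GradientFlowExistence

variable {E : Type*} [NormedAddCommGroup E] [InnerProductSpace ℝ E] [CompleteSpace E]
  {f : E → ℝ} {m κ a : ℝ}

open scoped NNReal in
theorem exists_isGradientFlow (hf : Differentiable ℝ f) (ha : 0 < a) (hκ : 0 < κ) {x₀ : E} {ρ : ℝ}
    (hρ : 0 < ρ) {K : ℝ≥0} (hlip : LipschitzOnWith K (gradient f) (Metric.closedBall x₀ ρ))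
    (hm : ∀ x ∈ Metric.closedBall x₀ ρ, m ≤ f x)
    (hPL : ∀ x ∈ Metric.ball x₀ ρ, κ * (f x - m) ≤ ‖gradient f x‖ ^ 2)
    (hsmall : a * (f x₀ - m) + 1 / (κ * a) < ρ) :
    ∃ w, IsGradientFlow f x₀ w := by
  set X : E → E := fun x => -(gradient f (ballRetraction x₀ ρ x)) with hXdef
  have hX : LipschitzWith (K * 2) X := by
    refine LipschitzWith.neg ?_
    rw [← lipschitzOnWith_univ]
    exact hlip.comp (lipschitzWith_ballRetraction x₀ hρ).lipschitzOnWith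
      (fun x _ => ballRetraction_mem_closedBall x₀ x hρ)
  have hL : ∀ x, ‖X x‖ ≤ (‖gradient f x₀‖₊ + K * ⟨ρ, hρ.le⟩ : ℝ≥0) := by
    intro x
    have hmem := ballRetraction_mem_closedBall x₀ x hρ
    have h1 := hlip.dist_le_mul _ hmem _ (Metric.mem_closedBall_self hρ.le)
    have h2 : (K : ℝ) * dist (ballRetraction x₀ ρ x) x₀ ≤ K * ρ := by
      gcongr; exact hmem
    rw [dist_eq_norm] at h1
    have h3 := norm_le_norm_add_norm_sub' (gradient f (ballRetraction x₀ ρ x)) (gradient f x₀)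
    rw [hXdef]
    simp only [norm_neg]
    push_cast
    change _ ≤ _ + (K : ℝ) * ρ
    linarith
  obtain ⟨w, hw0, hw⟩ := exists_forall_hasDerivWithinAt_Ici_of_lipschitzWith_of_bounded hX hL x₀
  have hwX : ∀ t, w t ∈ Metric.ball x₀ ρ → X (w t) = -(gradient f (w t)) := fun t ht => by
    rw [hXdef]
    simp only [ballRetraction_eq_self hρ (Metric.ball_subset_closedBall ht)]
  have hball : ∀ t, 0 ≤ t → w t ∈ Metric.ball x₀ ρ := fun t ht =>
    flow_mem_ball hf ha hκ hρ.le hw0 (fun t ht => (hw t ht).continuousWithinAt)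
      (fun t ht hmem => by rw [← hwX t hmem]; exact hw t ht) hm hPL hsmall ht
  exact ⟨w, hw0, fun t ht => by rw [← hwX t (hball t ht)]; exact hw t ht⟩

end GradientFlowExistence

/-! ### The scaled objective -/

section ScaledObjective

variable {E F : Type*} [NormedAddCommGroup E] [InnerProductSpace ℝ E]
  [NormedAddCommGroup F] [InnerProductSpace ℝ F]
  {R : F → ℝ} {h : E → F}

theorem Differentiable.scaledObjective (hR : Differentiable ℝ R) (hh : Differentiable ℝ h) (α : ℝ) :
    Differentiable ℝ (scaledObjective R h α) :=
  (hR.comp (hh.const_smul α)).const_mul _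

variable [CompleteSpace E] [CompleteSpace F]

theorem gradient_scaledObjective (hR : Differentiable ℝ R) (hh : Differentiable ℝ h) {α : ℝ}
    (hα : α ≠ 0) (w : E) :
    gradient (scaledObjective R h α) w =
      ContinuousLinearMap.adjoint (fderiv ℝ h w) (α⁻¹ • gradient R (α • h w)) := by
  refine ext_inner_right ℝ fun v => ?_
  have h1 : HasFDerivAt (scaledObjective R h α)
      ((1 / α ^ 2) • (fderiv ℝ R (α • h w) ∘L (α • fderiv ℝ h w))) w :=
    ((hR _).hasFDerivAt.comp w ((hh w).hasFDerivAt.const_smul α)).const_mul _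
  rw [inner_gradient_left, h1.fderiv, ContinuousLinearMap.adjoint_inner_left, inner_smul_left,
    inner_gradient_left]
  simp
  field_simp

theorem LocallyLipschitz.gradient_scaledObjective (hR : Differentiable ℝ R)
    (hRl : LocallyLipschitz (gradient R)) (hh : Differentiable ℝ h)
    (hhl : LocallyLipschitz (fderiv ℝ h)) {α : ℝ} (hα : α ≠ 0) :
    LocallyLipschitz (gradient (scaledObjective R h α)) := by
  have hC1 : ContDiff ℝ 1 h := contDiff_one_iff_fderiv.2 ⟨hh, hhl.continuous⟩
  have h1 : LocallyLipschitz fun w => ContinuousLinearMap.adjoint (fderiv ℝ h w) :=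
    (ContinuousLinearMap.adjoint (𝕜 := ℝ) (E := E)
      (F := F)).isometry.lipschitz.locallyLipschitz.comp hhl
  have h2 : LocallyLipschitz fun w => α⁻¹ • gradient R (α • h w) :=
    (lipschitzWith_smul α⁻¹).locallyLipschitz.comp
      (hRl.comp ((lipschitzWith_smul α).locallyLipschitz.comp hC1.locallyLipschitz))
  have h3 : ContDiff ℝ 1 fun q : (F →L[ℝ] E) × F => q.1 q.2 :=
    isBoundedBilinearMap_apply.contDiff
  have h4 := h3.locallyLipschitz.comp (h1.prodMk h2)
  have h5 : gradient (scaledObjective R h α) =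
      (fun q : (F →L[ℝ] E) × F => q.1 q.2) ∘ fun w =>
        (ContinuousLinearMap.adjoint (fderiv ℝ h w), α⁻¹ • gradient R (α • h w)) :=
    funext fun w => _root_.gradient_scaledObjective hR hh hα w
  rw [h5]
  exact h4

end ScaledObjective

theorem scaledObjective_add_inner_add_le {X F : Type*} [NormedAddCommGroup F]
    [InnerProductSpace ℝ F] [CompleteSpace F] {R : F → ℝ} {h : X → F} {m : ℝ}
    (hRc : StrongConvexOn univ m R) (hR : Differentiable ℝ R) {α : ℝ} (hα : α ≠ 0) (w w' : X) :
    scaledObjective R h α w + inner ℝ (α⁻¹ • gradient R (α • h w)) (h w' - h w)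
      + m / 2 * ‖h w' - h w‖ ^ 2 ≤ scaledObjective R h α w' := by
  have h1 := hRc.add_inner_gradient_add_le (hR (α • h w)) (α • h w')
  rw [← smul_sub, inner_smul_right, norm_smul, mul_pow, Real.norm_eq_abs, sq_abs] at h1
  have h2 := mul_le_mul_of_nonneg_left h1 (by positivity : 0 ≤ 1 / α ^ 2)
  unfold scaledObjective
  rw [inner_smul_left]
  simp only [conj_trivial]
  refine le_of_eq_of_le ?_ h2
  field_simp

/-- First-order Taylor estimate for a Lipschitz derivative, without the sharp factor `1/2`. -/
theorem norm_image_sub_sub_fderiv_le {E F : Type*} [NormedAddCommGroup E] [NormedSpace ℝ E]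
    [NormedAddCommGroup F] [NormedSpace ℝ F] {h : E → F} (hh : Differentiable ℝ h) {s : Set E}
    (hs : Convex ℝ s) {L : NNReal} (hL : LipschitzOnWith L (fderiv ℝ h) s) {x y : E}
    (hx : x ∈ s) (hy : y ∈ s) :
    ‖h y - h x - fderiv ℝ h x (y - x)‖ ≤ L * ‖y - x‖ ^ 2 := by
  have hseg : segment ℝ x y ⊆ s := hs.segment_subset hx hy
  have := (convex_segment (𝕜 := ℝ) x y).norm_image_sub_le_of_norm_hasFDerivWithin_le'
    (f := h) (f' := fderiv ℝ h) (φ := fderiv ℝ h x) (C := L * ‖y - x‖)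
    (fun z _ => (hh z).hasFDerivAt.hasFDerivWithinAt)
    (fun z hz => by
      have h1 := hL.dist_le_mul z (hseg hz) x hx
      rw [dist_eq_norm, dist_eq_norm] at h1
      refine h1.trans ?_
      gcongr
      exact norm_sub_le_of_mem_segment hz)
    (left_mem_segment ℝ x y) (right_mem_segment ℝ x y)
  rwa [mul_assoc, ← sq] at this

/-! ### The uniform Polyak–Łojasiewicz inequality -/

section PL

variable {E F : Type*} [NormedAddCommGroup E] [InnerProductSpace ℝ E] [FiniteDimensional ℝ E]
  [NormedAddCommGroup F] [InnerProductSpace ℝ F] [CompleteSpace F]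

/-- The Polyak–Łojasiewicz inequality for `F_α` near `w₀`, with a constant and a radius that do not
depend on `α`. The reference value `F_α(w')` may be taken at any point of the ball. -/
theorem exists_uniform_polyakLojasiewicz {h : E → F} {R : F → ℝ} {w₀ : E}
    (hh : Differentiable ℝ h) (hhl : LocallyLipschitz (fderiv ℝ h)) (hR : Differentiable ℝ R)
    {M : NNReal} (hRl : LipschitzWith M (gradient R)) {m : ℝ} (hm : 0 < m)
    (hRc : StrongConvexOn univ m R) (h0 : h w₀ = 0) {r : ℕ}
    (hr : ∀ᶠ w in 𝓝 w₀,
      Module.finrank ℝ (LinearMap.range (fderiv ℝ h w).toLinearMap) = r) :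
    ∃ κ > 0, ∃ ρ > 0, ∃ α₀ > 0, ∀ α : ℝ, α₀ ≤ α → ∀ w ∈ Metric.closedBall w₀ ρ,
      ∀ w' ∈ Metric.closedBall w₀ ρ,
        κ * (scaledObjective R h α w - scaledObjective R h α w') ≤
          ‖gradient (scaledObjective R h α) w‖ ^ 2 := by
  have hC1 : ContDiff ℝ 1 h := contDiff_one_iff_fderiv.2 ⟨hh, hhl.continuous⟩
  obtain ⟨C, hC, hlift⟩ := exists_lift_norm_sub_le_of_finrank_range_const hC1 hr
  obtain ⟨L, t, ht, hL⟩ := hhl w₀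
  obtain ⟨ε, hε, hεt⟩ := Metric.mem_nhds_iff.1 ht
  obtain ⟨δ, hδ, hδlift⟩ := hlift _ (Metric.ball_mem_nhds w₀ hε)
  -- `η` is the bound on `‖∇R(α h(w)) / α‖` under which the Taylor error is at most `m d² / 4`
  set η := m / (4 * (L * C ^ 2 + 1)) with hη
  have hLC : 0 < 4 * ((L : ℝ) * C ^ 2 + 1) := by positivity
  have hηpos : 0 < η := by positivity
  have hηm : η * (L * C ^ 2) ≤ m / 4 := by
    have : η * (4 * (L * C ^ 2 + 1)) = m := div_mul_cancel₀ _ hLC.ne'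
    linarith
  have hsmall : ∀ᶠ w in 𝓝 w₀, M * ‖h w‖ < η / 2 := by
    have : Continuous fun w => (M : ℝ) * ‖h w‖ := continuous_const.mul hh.continuous.norm
    exact this.continuousAt.eventually (Iio_mem_nhds (by simpa [h0] using hηpos))
  obtain ⟨δ', hδ', hδsmall⟩ := Metric.eventually_nhds_iff_ball.1 hsmall
  have hρpos : 0 < min ε (min δ δ') := lt_min hε (lt_min hδ hδ')
  refine ⟨m / C ^ 2, by positivity, min ε (min δ δ') / 2, half_pos hρpos,
    2 * ‖gradient R 0‖ / η + 1, by positivity, fun α hα w hw w' hw' => ?_⟩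
  have hαpos : 0 < α := lt_of_lt_of_le (by positivity) hα
  have hsub := Metric.closedBall_subset_ball (x := w₀) (half_lt_self hρpos)
  have hwε : w ∈ Metric.ball w₀ ε := Metric.ball_subset_ball (min_le_left _ _) (hsub hw)
  have hball2 : ∀ x ∈ Metric.closedBall w₀ (min ε (min δ δ') / 2), x ∈ Metric.ball w₀ δ :=
    fun x hx => Metric.ball_subset_ball ((min_le_right _ _).trans (min_le_left _ _)) (hsub hx)
  have hwδ' : w ∈ Metric.ball w₀ δ' :=
    Metric.ball_subset_ball ((min_le_right _ _).trans (min_le_right _ _)) (hsub hw)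
  obtain ⟨w'', hw'', hhw, hlen⟩ := hδlift w (hball2 w hw) w' (hball2 w' hw')
  set g := α⁻¹ • gradient R (α • h w) with hg
  set d := ‖h w' - h w‖ with hd
  set G := ‖gradient (scaledObjective R h α) w‖ with hG
  have hgη : ‖g‖ ≤ η := by
    have h1 : ‖gradient R (α • h w)‖ ≤ ‖gradient R 0‖ + M * (α * ‖h w‖) := by
      have h2 := hRl.dist_le_mul (α • h w) 0
      rw [dist_eq_norm, dist_zero_right, norm_smul, Real.norm_of_nonneg hαpos.le] at h2
      have h3 := norm_le_norm_add_norm_sub' (gradient R (α • h w)) (gradient R 0)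
      linarith
    have h4 : 2 * ‖gradient R 0‖ / η ≤ α := by linarith
    rw [div_le_iff₀ hηpos] at h4
    rw [hg, norm_smul, norm_inv, Real.norm_of_nonneg hαpos.le, inv_mul_le_iff₀ hαpos]
    have h5 := mul_le_mul_of_nonneg_left (hδsmall w hwδ').le hαpos.le
    linarith
  have hconv := scaledObjective_add_inner_add_le (h := h) hRc hR hαpos.ne' w w'
  rw [← hg, ← hd] at hconv
  have htaylor := norm_image_sub_sub_fderiv_le hh (convex_ball w₀ ε) (hL.mono hεt) hwε hw''
  rw [hhw] at htaylor
  have hinner : -(G * (C * d)) - η * (L * (C * d) ^ 2) ≤ inner ℝ g (h w' - h w) := by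
    have hsplit : inner ℝ g (h w' - h w) =
        inner ℝ (gradient (scaledObjective R h α) w) (w'' - w)
          + inner ℝ g (h w' - h w - fderiv ℝ h w (w'' - w)) := by
      rw [gradient_scaledObjective hR hh hαpos.ne' w, ← hg,
        ContinuousLinearMap.adjoint_inner_left, ← inner_add_right, add_sub_cancel]
    have h1 : -(G * (C * d)) ≤ inner ℝ (gradient (scaledObjective R h α) w) (w'' - w) := by
      refine le_trans ?_ (neg_le_of_abs_le (abs_real_inner_le_norm _ _))
      gcongr
    have h2 : -(η * (L * (C * d) ^ 2)) ≤ inner ℝ g (h w' - h w - fderiv ℝ h w (w'' - w)) := by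
      refine le_trans ?_ (neg_le_of_abs_le (abs_real_inner_le_norm _ _))
      have : ‖h w' - h w - fderiv ℝ h w (w'' - w)‖ ≤ L * (C * d) ^ 2 := htaylor.trans (by gcongr)
      gcongr
    rw [hsplit]
    linarith
  have h6 : η * (L * (C * d) ^ 2) ≤ m / 4 * d ^ 2 := by
    have := mul_le_mul_of_nonneg_right hηm (sq_nonneg d)
    calc _ = η * (L * C ^ 2) * d ^ 2 := by ring
      _ ≤ _ := this
  have h7 : scaledObjective R h α w - scaledObjective R h α w' ≤ G * (C * d) - m / 4 * d ^ 2 := by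
    linarith
  rw [div_mul_eq_mul_div, div_le_iff₀ (by positivity)]
  -- complete the square in `d`
  have h8 := mul_le_mul_of_nonneg_left h7 hm.le
  linarith [sq_nonneg (G * C - m / 2 * d)]

end PL

/-! ### Convergence of the scaled flow -/

end

theorem theorem4
    {F : Type*} [NormedAddCommGroup F] [InnerProductSpace ℝ F] [CompleteSpace F]
    [TopologicalSpace.SeparableSpace F]
    (p : ℕ) (h : EuclideanSpace ℝ (Fin p) → F) (R : F → ℝ) (w₀ : EuclideanSpace ℝ (Fin p))
    (h_diff : Differentiable ℝ h) (h_lip : LocallyLipschitz (fderiv ℝ h))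
    (R_nonneg : ∀ y, 0 ≤ R y) (R_diff : Differentiable ℝ R)
    (R_lip : ∃ M : NNReal, LipschitzWith M (gradient R))
    (R_convex : ∃ m : ℝ, 0 < m ∧ StrongConvexOn univ m R)
    (h_zero : h w₀ = 0)
    (h_rank : ∃ r : ℕ, ∀ᶠ w in 𝓝 w₀,
      Module.finrank ℝ (LinearMap.range (fderiv ℝ h w).toLinearMap) = r) :
    ∃ α₀ C c : ℝ, 0 < α₀ ∧ 0 < C ∧ 0 < c ∧
      ∀ α : ℝ, α₀ ≤ α →
        (∃ w : ℝ → EuclideanSpace ℝ (Fin p), IsGradientFlow (scaledObjective R h α) w₀ w) ∧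
        ∀ w : ℝ → EuclideanSpace ℝ (Fin p), IsGradientFlow (scaledObjective R h α) w₀ w →
          ∃ w_lim : EuclideanSpace ℝ (Fin p),
            IsLocalMin (scaledObjective R h α) w_lim ∧
            ∀ t : ℝ, 0 ≤ t → ‖w t - w_lim‖ ≤ C / α * Real.exp (-c * t) := by
  obtain ⟨M, hM⟩ := R_lip
  obtain ⟨m, hm, hconv⟩ := R_convex
  obtain ⟨r, hr⟩ := h_rank
  obtain ⟨κ, hκ, ρ, hρ, α₀, hα₀, hPL⟩ :=
    exists_uniform_polyakLojasiewicz h_diff h_lip R_diff hM hm hconv h_zero hr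
  have hR0 := R_nonneg 0
  have hCpos : 0 < R 0 + 1 / κ := by positivity
  refine ⟨max α₀ ((R 0 + 1 / κ) / ρ + 1), R 0 + 1 / κ, κ / 2, lt_max_of_lt_left hα₀, hCpos,
    half_pos hκ, fun α hα => ?_⟩
  have hαpos : 0 < α := hα₀.trans_le ((le_max_left _ _).trans hα)
  have hf := R_diff.scaledObjective h_diff α
  obtain ⟨x, hx, hxmin⟩ := (isCompact_closedBall w₀ ρ).exists_isMinOn
    ⟨w₀, Metric.mem_closedBall_self hρ.le⟩ hf.continuous.continuousOn
  have hx0 : 0 ≤ scaledObjective R h α x := mul_nonneg (by positivity) (R_nonneg _)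
  have hPLx : ∀ y ∈ Metric.ball w₀ ρ,
      κ * (scaledObjective R h α y - scaledObjective R h α x) ≤
        ‖gradient (scaledObjective R h α) y‖ ^ 2 := fun y hy =>
    hPL α ((le_max_left _ _).trans hα) y (Metric.ball_subset_closedBall hy) x hx
  have hV : α * (scaledObjective R h α w₀ - scaledObjective R h α x) + 1 / (κ * α)
      ≤ (R 0 + 1 / κ) / α := by
    have h1 : α * scaledObjective R h α w₀ + 1 / (κ * α) = (R 0 + 1 / κ) / α := by
      rw [scaledObjective, h_zero, smul_zero]; field_simp
    rw [← h1]
    linarith [mul_nonneg hαpos.le hx0]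
  have hVρ : (R 0 + 1 / κ) / α < ρ := by
    have h1 : (R 0 + 1 / κ) / ρ < α := by
      linarith [(le_max_right α₀ ((R 0 + 1 / κ) / ρ + 1)).trans hα]
    rw [div_lt_iff₀ hρ] at h1
    rw [div_lt_iff₀ hαpos]
    linarith
  obtain ⟨K, hK⟩ := (LocallyLipschitz.gradient_scaledObjective R_diff hM.locallyLipschitz h_diff
    h_lip hαpos.ne').locallyLipschitzOn.exists_lipschitzOnWith_of_compact
      (isCompact_closedBall w₀ ρ)
  refine ⟨exists_isGradientFlow hf hαpos hκ hρ hK hxmin hPLx (hV.trans_lt hVρ), fun w hw => ?_⟩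
  obtain ⟨y, hy, hlim⟩ := exists_lim_of_flow hf hαpos hκ hρ.le hw hxmin hPLx (hV.trans_lt hVρ)
  exact ⟨y, hy, fun t ht => (hlim t ht).trans (by gcongr)⟩
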